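/- **Theorem 1.1.** Let $X=\ell_p(\mathbb Z)$ with $1\le p<\infty$, or $X=c_0(\mathbb Z)$ (real or complex scalars), and let $w=(w_n)_{n\in\mathbb Z}$ be a sequence of positive real numbers with $0<\inf_n w_n\le\sup_n w_n<\infty$. Let $B_w:X\to X$, $B_w\big((x_n)_{n\in\mathbb Z}\big)=(w_{n+1}x_{n+1})_{n\in\mathbb Z}$, be the associated bilateral weighted shift. A bounded operator $T$ on $X$ is called *strongly structurally stable* if for every $\varepsilon>0$ there is $\delta>0$ such that, for every Lipschitz map $\alpha:X\to X$ with $\sup_x\|\alpha(x)\|\le\delta$ and Lipschitz constant at most $\delta$, there is a map $\varphi:X\to X$ with $\sup_x\|\varphi(x)\|\le\varepsilon$ such that $I+\varphi$ is a homeomorphism of $X$ onto $X$ and $T\circ(I+\varphi)=(I+\varphi)\circ(T+\alpha)$. Then $B_w$ is strongly structurally stable if and only if one of the following conditions holds (each limit being required to exist): - (A) $\displaystyle\lim_{n\to+\infty}\ \sup_{k\in\mathbb Z}\,(w_k\cdots w_{k+n})^{1/n}<1$; - (B) $\displaystyle\lim_{n\to+\infty}\ \inf_{k\in\mathbb Z}\,(w_k\cdots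 w_{k+n})^{1/n}>1$; - (C) $\displaystyle\lim_{n\to+\infty}\ \sup_{k\ge1}\,(w_{-k}w_{-k-1}\cdots w_{-k-n})^{1/n}<1$ and $\displaystyle\lim_{n\to+\infty}\ \inf_{k\ge1}\,(w_kw_{k+1}\cdots w_{k+n})^{1/n}>1$. -/

import Mathlib

open scoped ENNReal ZeroAtInfty
open Filter Topology

namespace BilateralShift

/-- A map `T : E → E` is strongly structurally stable if for every `ε > 0` there is `δ > 0` such
that, for every Lipschitz map `α : E → E` with `‖α‖_∞ ≤ δ` and `Lip(α) ≤ δ`, there is a map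
`φ : E → E` with `‖φ‖_∞ ≤ ε`, with `I + φ` a homeomorphism of `E` onto `E`, and with
`T ∘ (I + φ) = (I + φ) ∘ (T + α)`. -/
def StronglyStructurallyStable {E : Type*} [NormedAddCommGroup E] (T : E → E) : Prop :=
  ∀ ε : ℝ, 0 < ε → ∃ δ : ℝ, 0 < δ ∧
    ∀ α : E → E, (∀ x, ‖α x‖ ≤ δ) → (∀ x y, ‖α x - α y‖ ≤ δ * ‖x - y‖) →
      ∃ φ : E → E, (∀ x, ‖φ x‖ ≤ ε) ∧ IsHomeomorph (fun x => x + φ x) ∧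
        ∀ x, T (x + φ x) = (T x + α x) + φ (T x + α x)

/-- A sequence of positive real numbers indexed by `ℤ`, bounded, and bounded below by a positive
constant. -/
def IsAdmissibleWeight (w : ℤ → ℝ) : Prop :=
  (∃ a : ℝ, 0 < a ∧ ∀ n, a ≤ w n) ∧ (∃ b : ℝ, ∀ n, w n ≤ b)

theorem IsAdmissibleWeight.exists_norm_le {w : ℤ → ℝ} (hw : IsAdmissibleWeight w)
    (𝕜 : Type*) [RCLike 𝕜] : ∃ b : ℝ, 0 ≤ b ∧ ∀ n, ‖((w n : ℝ) : 𝕜)‖ ≤ b := by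
  obtain ⟨⟨a, ha, hal⟩, b, hb⟩ := hw
  refine ⟨b, (ha.le.trans (hal 0)).trans (hb 0), fun n => ?_⟩
  rw [RCLike.norm_ofReal, abs_of_pos (ha.trans_le (hal n))]
  exact hb n

/-- The formal bilateral weighted shift `(x_n)_n ↦ (w_{n+1} x_{n+1})_n` on sequences. -/
def shiftFun {𝕜 : Type*} [RCLike 𝕜] (w : ℤ → ℝ) (x : ℤ → 𝕜) : ℤ → 𝕜 :=
  fun n => ((w (n + 1) : ℝ) : 𝕜) * x (n + 1)

theorem memℓp_shiftFun {𝕜 : Type*} [RCLike 𝕜] {p : ℝ≥0∞} [Fact (1 ≤ p)] (hp : p ≠ ∞)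
    {w : ℤ → ℝ} (hw : IsAdmissibleWeight w) (x : lp (fun _ : ℤ => 𝕜) p) :
    Memℓp (shiftFun w x) p := by
  obtain ⟨b, hb0, hb⟩ := hw.exists_norm_le 𝕜
  have hp0 : 0 < p.toReal :=
    ENNReal.toReal_pos (zero_lt_one.trans_le Fact.out).ne' hp
  refine memℓp_gen ?_
  have h1 : Summable fun n : ℤ => ‖x (n + 1)‖ ^ p.toReal :=
    (Equiv.addRight (1 : ℤ)).summable_iff.2 ((lp.memℓp x).summable hp0)
  refine (h1.mul_left (b ^ p.toReal)).of_nonneg_of_le (fun n => by positivity) (fun n => ?_)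
  rw [← Real.mul_rpow hb0 (norm_nonneg _), shiftFun, norm_mul]
  gcongr
  exact hb _

theorem norm_shiftFun_le {𝕜 : Type*} [RCLike 𝕜] {p : ℝ≥0∞} [Fact (1 ≤ p)] (hp : p ≠ ∞)
    {w : ℤ → ℝ} (hw : IsAdmissibleWeight w) :
    ∃ b : ℝ, ∀ x : lp (fun _ : ℤ => 𝕜) p,
      ‖(⟨shiftFun w x, memℓp_shiftFun hp hw x⟩ : lp (fun _ : ℤ => 𝕜) p)‖ ≤ b * ‖x‖ := by
  obtain ⟨b, hb0, hb⟩ := hw.exists_norm_le 𝕜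
  have hp0 : 0 < p.toReal :=
    ENNReal.toReal_pos (zero_lt_one.trans_le Fact.out).ne' hp
  refine ⟨b, fun x => lp.norm_le_of_tsum_le hp0 (by positivity) ?_⟩
  have h0 : Summable fun n : ℤ => ‖x n‖ ^ p.toReal := (lp.memℓp x).summable hp0
  have h1 : Summable fun n : ℤ => ‖x (n + 1)‖ ^ p.toReal :=
    (Equiv.addRight (1 : ℤ)).summable_iff.2 h0
  have h2 : ∑' n : ℤ, ‖x (n + 1)‖ ^ p.toReal = ∑' n : ℤ, ‖x n‖ ^ p.toReal :=
    (Equiv.addRight (1 : ℤ)).tsum_eq (fun n : ℤ => ‖x n‖ ^ p.toReal)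
  have hle : ∀ n : ℤ, ‖shiftFun w x n‖ ^ p.toReal ≤ b ^ p.toReal * ‖x (n + 1)‖ ^ p.toReal := by
    intro n
    rw [← Real.mul_rpow hb0 (norm_nonneg _), shiftFun, norm_mul]
    gcongr
    exact hb _
  calc ∑' n : ℤ, ‖shiftFun w x n‖ ^ p.toReal
      ≤ ∑' n : ℤ, b ^ p.toReal * ‖x (n + 1)‖ ^ p.toReal :=
        ((memℓp_shiftFun hp hw x).summable hp0).tsum_le_tsum hle (h1.mul_left _)
    _ = (b * ‖x‖) ^ p.toReal := by
        rw [tsum_mul_left, h2, Real.mul_rpow hb0 (norm_nonneg _), lp.norm_rpow_eq_tsum hp0]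

/-- The bilateral weighted shift `B_w` as a bounded operator on `ℓ_p(ℤ)`, `1 ≤ p < ∞`. -/
noncomputable def shiftLp (𝕜 : Type*) [RCLike 𝕜] (p : ℝ≥0∞) [Fact (1 ≤ p)] (hp : p ≠ ∞)
    (w : ℤ → ℝ) (hw : IsAdmissibleWeight w) :
    lp (fun _ : ℤ => 𝕜) p →L[𝕜] lp (fun _ : ℤ => 𝕜) p :=
  LinearMap.mkContinuousOfExistsBound
    { toFun := fun x => ⟨shiftFun w x, memℓp_shiftFun hp hw x⟩
      map_add' := fun _ _ => Subtype.ext (funext fun _ => mul_add _ _ _)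
      map_smul' := fun _ _ => Subtype.ext (funext fun _ => mul_left_comm _ _ _) }
    (norm_shiftFun_le hp hw)

theorem tendsto_shiftFun {𝕜 : Type*} [RCLike 𝕜] {w : ℤ → ℝ} (hw : IsAdmissibleWeight w)
    (x : C₀(ℤ, 𝕜)) : Tendsto (shiftFun w x) (cocompact ℤ) (𝓝 0) := by
  obtain ⟨b, hb0, hb⟩ := hw.exists_norm_le 𝕜
  have h1 : Tendsto (fun n : ℤ => x (n + 1)) (cocompact ℤ) (𝓝 0) :=
    x.zero_at_infty'.comp (Homeomorph.addRight (1 : ℤ)).isClosedEmbedding.tendsto_cocompact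
  refine squeeze_zero_norm (a := fun n : ℤ => b * ‖x (n + 1)‖) (fun n => ?_) ?_
  · rw [shiftFun, norm_mul]
    gcongr
    exact hb _
  · simpa using h1.norm.const_mul b

theorem norm_shiftC0_le {𝕜 : Type*} [RCLike 𝕜] {w : ℤ → ℝ} (hw : IsAdmissibleWeight w) :
    ∃ b : ℝ, ∀ x : C₀(ℤ, 𝕜),
      ‖(⟨⟨shiftFun w x, continuous_of_discreteTopology⟩, tendsto_shiftFun hw x⟩ : C₀(ℤ, 𝕜))‖
        ≤ b * ‖x‖ := by
  obtain ⟨b, hb0, hb⟩ := hw.exists_norm_le 𝕜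
  refine ⟨b, fun x => ?_⟩
  rw [← ZeroAtInftyContinuousMap.norm_toBCF_eq_norm]
  refine (BoundedContinuousFunction.norm_le (by positivity)).2 fun n => ?_
  change ‖((w (n + 1) : ℝ) : 𝕜) * x (n + 1)‖ ≤ _
  rw [norm_mul]
  refine mul_le_mul (hb _) ?_ (norm_nonneg _) hb0
  rw [← ZeroAtInftyContinuousMap.norm_toBCF_eq_norm]
  exact x.toBCF.norm_coe_le_norm (n + 1)

/-- The bilateral weighted shift `B_w` as a bounded operator on `c_0(ℤ)`, the space of sequences
indexed by the discrete space `ℤ` that tend to zero at infinity, with the sup norm. -/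
noncomputable def shiftC0 (𝕜 : Type*) [RCLike 𝕜] (w : ℤ → ℝ) (hw : IsAdmissibleWeight w) :
    C₀(ℤ, 𝕜) →L[𝕜] C₀(ℤ, 𝕜) :=
  LinearMap.mkContinuousOfExistsBound
    { toFun := fun x =>
        ⟨⟨shiftFun w x, continuous_of_discreteTopology⟩, tendsto_shiftFun hw x⟩
      map_add' := fun x y => by ext n; simp [shiftFun, mul_add]
      map_smul' := fun c x => by ext n; simp [shiftFun, mul_left_comm] }
    (norm_shiftC0_le hw)

theorem shiftLp_apply (𝕜 : Type*) [RCLike 𝕜] (p : ℝ≥0∞) [Fact (1 ≤ p)] (hp : p ≠ ∞)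
    (w : ℤ → ℝ) (hw : IsAdmissibleWeight w) (x : lp (fun _ : ℤ => 𝕜) p) (n : ℤ) :
    shiftLp 𝕜 p hp w hw x n = ((w (n + 1) : ℝ) : 𝕜) * x (n + 1) := rfl

theorem shiftC0_apply (𝕜 : Type*) [RCLike 𝕜] (w : ℤ → ℝ) (hw : IsAdmissibleWeight w)
    (x : C₀(ℤ, 𝕜)) (n : ℤ) :
    shiftC0 𝕜 w hw x n = ((w (n + 1) : ℝ) : 𝕜) * x (n + 1) := rfl

/-- `(w_k w_{k+1} ⋯ w_{k+n})^{1/n}`. -/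
noncomputable def forwardMean (w : ℤ → ℝ) (k : ℤ) (n : ℕ) : ℝ :=
  (∏ i ∈ Finset.range (n + 1), w (k + (i : ℤ))) ^ (1 / (n : ℝ))

/-- `(w_k w_{k-1} ⋯ w_{k-n})^{1/n}`. -/
noncomputable def backwardMean (w : ℤ → ℝ) (k : ℤ) (n : ℕ) : ℝ :=
  (∏ i ∈ Finset.range (n + 1), w (k - (i : ℤ))) ^ (1 / (n : ℝ))

/-- `lim_n sup_{k ∈ ℤ} (w_k ⋯ w_{k+n})^{1/n} < 1`. -/
def ConditionA (w : ℤ → ℝ) : Prop :=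
  ∃ L : ℝ, Tendsto (fun n : ℕ => ⨆ k : ℤ, forwardMean w k n) atTop (𝓝 L) ∧ L < 1

/-- `lim_n inf_{k ∈ ℤ} (w_k ⋯ w_{k+n})^{1/n} > 1`. -/
def ConditionB (w : ℤ → ℝ) : Prop :=
  ∃ L : ℝ, Tendsto (fun n : ℕ => ⨅ k : ℤ, forwardMean w k n) atTop (𝓝 L) ∧ 1 < L

/-- `lim_n sup_{k ≥ 1} (w_{-k} ⋯ w_{-k-n})^{1/n} < 1` and
`lim_n inf_{k ≥ 1} (w_k ⋯ w_{k+n})^{1/n} > 1`. -/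
def ConditionC (w : ℤ → ℝ) : Prop :=
  (∃ L : ℝ, Tendsto (fun n : ℕ => ⨆ k : ℕ+, backwardMean w (-((k : ℕ) : ℤ)) n) atTop (𝓝 L) ∧
    L < 1) ∧
  (∃ L : ℝ, Tendsto (fun n : ℕ => ⨅ k : ℕ+, forwardMean w ((k : ℕ) : ℤ) n) atTop (𝓝 L) ∧
    1 < L)

end BilateralShift

/-!
Write `w n = u n / u (n - 1)` for a positive sequence `u`, a potential of the weight, so that
`‖B_w ^ n e_j‖ = u j / u (j - n)`. The suprema of these ratios are submultiplicative in `n`, and by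
Fekete's lemma the three conditions say that `B_w` contracts the unit vectors geometrically over all
of `ℤ`, or that its inverse does, or that `B_w` does so over the negative half and its inverse over
the nonnegative half. Reflecting `ℤ` about `-1/2` exchanges the roles of `B_w` and its inverse.

If one of the conditions holds, then propagating forwards in time the coordinates that are
contracted and backwards the others gives a summable Green kernel of `x (m + 1) = B_w (x m) + f m`.
Convolution with it along the orbits of `B_w + α` inverts the linear part of the conjugacy equation,
which the contraction principle then solves.

Conversely, suppose `B_w` is strongly structurally stable. Perturbing along a widely spaced orbit
forces a bounded solution of `b (j - 1) = w j * b j + δ` on `ℤ`, first on windows and then by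
compactness on the whole line. The sequence `v = u b` is decreasing, so it is nonnegative, or
nonpositive, or changes sign once; where it is nonnegative, `v` is squeezed between `δ u` and `u`
up to a shift and grows geometrically to the left, which is the contraction estimate. The three sign
patterns are the three conditions.
-/

namespace BilateralShift

open scoped BoundedContinuousFunction NNReal

section Growth

/-- Exponential decay of a real sequence: `M n ≤ C r ^ n` for all `n`, for some `C` and some
`r ∈ (0, 1)`. -/
def DecaysGeometrically (M : ℕ → ℝ) : Prop :=
  ∃ C : ℝ, ∃ r ∈ Set.Ioo (0 : ℝ) 1, ∀ n, M n ≤ C * r ^ n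

variable {M : ℕ → ℝ} {a : ℝ}

theorem exists_tendsto_log_div_of_submultiplicative (ha : 0 < a) (hM : ∀ n, a ^ n ≤ M n)
    (hmul : ∀ m n, M (m + n) ≤ M m * M n) :
    ∃ l, Tendsto (fun n : ℕ => Real.log (M n) / n) atTop (𝓝 l) ∧
      ∀ n : ℕ, n ≠ 0 → l ≤ Real.log (M n) / n := by
  have hpos (n : ℕ) : 0 < M n := (pow_pos ha n).trans_le (hM n)
  have hsub : Subadditive fun n => Real.log (M n) := fun m n => by
    rw [← Real.log_mul (hpos m).ne' (hpos n).ne']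
    exact Real.log_le_log (hpos _) (hmul m n)
  have hbdd : BddBelow (Set.range fun n : ℕ => Real.log (M n) / n) := by
    refine ⟨min 0 (Real.log a), ?_⟩
    rintro _ ⟨n, rfl⟩
    rcases n.eq_zero_or_pos with rfl | hn
    · simp
    · refine (min_le_right _ _).trans ?_
      rw [le_div_iff₀ (by positivity), mul_comm, ← Real.log_pow]
      exact Real.log_le_log (pow_pos ha n) (hM n)
  exact ⟨hsub.lim, hsub.tendsto_lim hbdd, fun n hn => hsub.lim_le_div hbdd hn⟩

theorem exists_tendsto_root_of_submultiplicative (ha : 0 < a) (hM : ∀ n, a ^ n ≤ M n)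
    (hmul : ∀ m n, M (m + n) ≤ M m * M n) :
    ∃ L, 0 < L ∧ Tendsto (fun n : ℕ => M (n + 1) ^ (1 / (n : ℝ))) atTop (𝓝 L) ∧
      ∀ n : ℕ, n ≠ 0 → L ^ n ≤ M n := by
  have hpos (n : ℕ) : 0 < M n := (pow_pos ha n).trans_le (hM n)
  obtain ⟨l, hl, hle⟩ := exists_tendsto_log_div_of_submultiplicative ha hM hmul
  refine ⟨Real.exp l, Real.exp_pos l, ?_, fun n hn => ?_⟩
  · have hshift : Tendsto
        (fun n : ℕ => Real.log (M (n + 1)) / (n + 1 : ℕ) * (1 + 1 / (n : ℝ))) atTop (𝓝 l) := by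
      have h := (hl.comp (tendsto_add_atTop_nat 1)).mul
        (tendsto_one_div_atTop_nhds_zero_nat.const_add 1)
      rwa [add_zero, mul_one] at h
    refine ((Real.continuous_exp.tendsto l).comp hshift).congr' ?_
    filter_upwards [eventually_gt_atTop 0] with n hn
    rw [Real.rpow_def_of_pos (hpos _), Function.comp_apply]
    congr 1
    push_cast
    field_simp
  · rw [← Real.exp_nat_mul, ← Real.le_log_iff_exp_le (hpos n), mul_comm,
      ← le_div_iff₀ (by positivity)]
    exact hle n hn

theorem decaysGeometrically_of_tendsto_root (hM : ∀ n, 0 < M n) {L : ℝ} (hL : L < 1)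
    (h : Tendsto (fun n : ℕ => M (n + 1) ^ (1 / (n : ℝ))) atTop (𝓝 L)) :
    DecaysGeometrically M := by
  obtain ⟨r, hr, hr1⟩ := exists_between (max_lt hL one_pos)
  have hr0 : 0 < r := (le_max_right _ _).trans_lt hr
  have hO : M =O[atTop] fun n => r ^ n := by
    rw [← map_add_atTop_eq_nat 1, Asymptotics.isBigO_map]
    refine Asymptotics.IsBigO.of_bound r⁻¹ ?_
    filter_upwards [h.eventually_lt_const ((le_max_left _ _).trans_lt hr), eventually_ne_atTop 0]
      with n hn hn0
    have hle : M (n + 1) ≤ r ^ n := by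
      rw [← Real.rpow_inv_natCast_pow (hM _).le hn0, ← one_div]
      exact pow_le_pow_left₀ (Real.rpow_nonneg (hM _).le _) hn.le n
    rwa [Function.comp_apply, Function.comp_apply, Real.norm_of_nonneg (hM _).le,
      Real.norm_of_nonneg (by positivity), pow_succ', inv_mul_cancel_left₀ hr0.ne']
  obtain ⟨C, -, hC⟩ := Asymptotics.bound_of_isBigO_nat_atTop hO
  refine ⟨C, r, ⟨hr0, hr1⟩, fun n => ?_⟩
  have := hC (x := n) (pow_pos hr0 n).ne'
  rwa [Real.norm_of_nonneg (hM n).le, Real.norm_of_nonneg (by positivity)] at this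

theorem lt_one_of_decaysGeometrically (h : DecaysGeometrically M) {L : ℝ}
    (hL : ∀ n : ℕ, n ≠ 0 → L ^ n ≤ M n) : L < 1 := by
  obtain ⟨C, r, hr, hC⟩ := h
  by_contra! hL1
  have hlim : Tendsto (fun n : ℕ => C * r ^ n) atTop (𝓝 0) := by
    simpa using (tendsto_pow_atTop_nhds_zero_of_lt_one hr.1.le hr.2).const_mul C
  obtain ⟨n, hn, hn0⟩ :=
    ((hlim.eventually_lt_const one_pos).and (eventually_ne_atTop 0)).exists
  exact ((one_le_pow₀ hL1).trans ((hL n hn0).trans (hC n))).not_gt hn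

theorem exists_tendsto_root_lt_one_iff (ha : 0 < a) (hM : ∀ n, a ^ n ≤ M n)
    (hmul : ∀ m n, M (m + n) ≤ M m * M n) :
    (∃ L, Tendsto (fun n : ℕ => M (n + 1) ^ (1 / (n : ℝ))) atTop (𝓝 L) ∧ L < 1) ↔
      DecaysGeometrically M := by
  constructor
  · rintro ⟨L, hL, hL1⟩
    exact decaysGeometrically_of_tendsto_root (fun n => (pow_pos ha n).trans_le (hM n)) hL1 hL
  · intro h
    obtain ⟨L, -, hL, hle⟩ := exists_tendsto_root_of_submultiplicative ha hM hmul
    exact ⟨L, hL, lt_one_of_decaysGeometrically h hle⟩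

theorem exists_tendsto_inv_root_gt_one_iff (ha : 0 < a) (hM : ∀ n, a ^ n ≤ M n)
    (hmul : ∀ m n, M (m + n) ≤ M m * M n) :
    (∃ L, Tendsto (fun n : ℕ => (M (n + 1) ^ (1 / (n : ℝ)))⁻¹) atTop (𝓝 L) ∧ 1 < L) ↔
      DecaysGeometrically M := by
  rw [← exists_tendsto_root_lt_one_iff ha hM hmul]
  constructor
  · rintro ⟨L, hL, hL1⟩
    refine ⟨L⁻¹, ?_, inv_lt_one_of_one_lt₀ hL1⟩
    simpa only [inv_inv] using hL.inv₀ (one_pos.trans hL1).ne'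
  · rintro ⟨L, hL, hL1⟩
    obtain ⟨L', hL'0, hL', -⟩ := exists_tendsto_root_of_submultiplicative ha hM hmul
    obtain rfl := tendsto_nhds_unique hL hL'
    exact ⟨L⁻¹, hL.inv₀ hL'0.ne', (one_lt_inv₀ hL'0).2 hL1⟩

variable {ι : Type*} [Nonempty ι] {x : ι → ℝ}

theorem iSup_root_eq (hx : ∀ i, 0 ≤ x i) {n : ℕ} (hn : n ≠ 0) :
    ⨆ i, x i ^ (1 / (n : ℝ)) = (⨆ i, x i) ^ (1 / (n : ℝ)) := by
  have hroot (i : ι) : 0 ≤ x i ^ (1 / (n : ℝ)) := Real.rpow_nonneg (hx i) _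
  have hpow : (⨆ i, x i ^ (1 / (n : ℝ))) ^ n = ⨆ i, x i := by
    rw [Real.iSup_pow hroot]
    exact iSup_congr fun i => by rw [one_div, Real.rpow_inv_natCast_pow (hx i) hn]
  rw [← hpow, one_div,
    Real.pow_rpow_inv_natCast (Real.iSup_nonneg fun i => by simpa only [one_div] using hroot i) hn]

theorem iInf_inv_eq (hx : ∀ i, 0 < x i) (hbdd : BddAbove (Set.range x)) :
    ⨅ i, (x i)⁻¹ = (⨆ i, x i)⁻¹ := by
  have hsup : 0 < ⨆ i, x i :=
    (hx (Classical.arbitrary ι)).trans_le (le_ciSup hbdd _)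
  have hanti : AntitoneOn (fun t : ℝ => t⁻¹) (Set.range x) := by
    rintro _ ⟨i, rfl⟩ _ - h
    exact inv_anti₀ (hx i) h
  have := hanti.map_csSup_of_continuousWithinAt
    (continuousAt_inv₀ hsup.ne').continuousWithinAt (Set.range_nonempty x) hbdd
  rw [iInf, iSup, this, ← Set.range_comp, Function.comp_def]

end Growth

section Potential

variable {w u : ℤ → ℝ} {b : ℝ}

/-- A positive sequence `u` on `ℤ` is a potential of the weight `w` if `w n = u n / u (n - 1)`.
Conjugating by the multiplication by `u` turns the weighted shift into the unweighted one. -/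
structure IsPotential (w u : ℤ → ℝ) : Prop where
  pos : ∀ n, 0 < u n
  eq_mul : ∀ n, u n = w n * u (n - 1)

theorem exists_isPotential (hw : ∀ n, 0 < w n) : ∃ u, IsPotential w u := by
  refine ⟨fun n => (∏ i ∈ Finset.Ioc 0 n, w i) / ∏ i ∈ Finset.Ioc n 0, w i, ⟨fun n =>
    div_pos (Finset.prod_pos fun i _ => hw i) (Finset.prod_pos fun i _ => hw i), fun n => ?_⟩⟩
  have hne : w n ≠ 0 := (hw n).ne'
  rcases le_or_gt n 0 with hn | hn
  · have hIoc : Finset.Ioc (n - 1) 0 = insert n (Finset.Ioc n 0) := by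
      ext i; simp only [Finset.mem_Ioc, Finset.mem_insert]; omega
    have hempty (m : ℤ) (hm : m ≤ 0) : Finset.Ioc 0 m = ∅ := Finset.Ioc_eq_empty hm.not_gt
    rw [hIoc, Finset.prod_insert (by simp), hempty n hn, hempty (n - 1) (by omega)]
    field_simp
  · have hIoc : Finset.Ioc 0 n = insert n (Finset.Ioc 0 (n - 1)) := by
      ext i; simp only [Finset.mem_Ioc, Finset.mem_insert]; omega
    have hempty (m : ℤ) (hm : 0 ≤ m) : Finset.Ioc m 0 = ∅ := Finset.Ioc_eq_empty hm.not_gt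
    rw [hIoc, Finset.prod_insert (by simp), hempty n hn.le, hempty (n - 1) (by omega),
      Finset.prod_empty, div_one, div_one]

/-- A positive sequence whose consecutive terms differ at most by the factor `b`: a potential of an
admissible weight. -/
structure HasBoundedRatios (b : ℝ) (u : ℤ → ℝ) : Prop where
  pos : ∀ n, 0 < u n
  le_mul_pred : ∀ n, u n ≤ b * u (n - 1)
  pred_le_mul : ∀ n, u (n - 1) ≤ b * u n

theorem IsAdmissibleWeight.pos (hw : IsAdmissibleWeight w) (n : ℤ) : 0 < w n :=
  let ⟨⟨_, ha, haw⟩, _⟩ := hw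
  ha.trans_le (haw n)

theorem IsAdmissibleWeight.exists_hasBoundedRatios (hw : IsAdmissibleWeight w)
    (hu : IsPotential w u) : ∃ b, HasBoundedRatios b u := by
  obtain ⟨⟨a, ha, haw⟩, b, hb⟩ := hw
  refine ⟨max b a⁻¹, hu.pos, fun n => ?_, fun n => ?_⟩
  · rw [hu.eq_mul n]
    exact mul_le_mul_of_nonneg_right ((hb n).trans (le_max_left _ _)) (hu.pos _).le
  · calc u (n - 1) = a⁻¹ * (a * u (n - 1)) := (inv_mul_cancel_left₀ ha.ne' _).symm
      _ ≤ a⁻¹ * (w n * u (n - 1)) := by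
        have := hu.pos (n - 1)
        have := haw n
        gcongr
      _ = a⁻¹ * u n := by rw [← hu.eq_mul n]
      _ ≤ max b a⁻¹ * u n := mul_le_mul_of_nonneg_right (le_max_right _ _) (hu.pos n).le

/-- The reflection of `ℤ` about `-1/2`, acting on sequences. It exchanges a potential of `w` with
one of the weight governing the inverse shift, and the two halves `n < 0` and `0 ≤ n` of `ℤ`. -/
def reflect (u : ℤ → ℝ) (n : ℤ) : ℝ := u (-1 - n)

namespace HasBoundedRatios

theorem pos_bound (hu : HasBoundedRatios b u) : 0 < b :=
  pos_of_mul_pos_left ((hu.pos 0).trans_le (hu.le_mul_pred 0)) (hu.pos _).le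

theorem reflect (hu : HasBoundedRatios b u) : HasBoundedRatios b (reflect u) where
  pos _ := hu.pos _
  le_mul_pred n := by
    convert hu.pred_le_mul (-n) using 2 <;> unfold BilateralShift.reflect <;> congr 1 <;> ring
  pred_le_mul n := by
    convert hu.le_mul_pred (-n) using 2 <;> unfold BilateralShift.reflect <;> congr 1 <;> ring

theorem le_pow_mul_sub (hu : HasBoundedRatios b u) (k : ℤ) (n : ℕ) :
    u k ≤ b ^ n * u (k - n) := by
  induction n with
  | zero => simp
  | succ n ih =>
    calc u k ≤ b ^ n * u (k - n) := ih
      _ ≤ b ^ n * (b * u (k - n - 1)) :=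
        mul_le_mul_of_nonneg_left (hu.le_mul_pred _) (pow_nonneg hu.pos_bound.le n)
      _ = b ^ (n + 1) * u (k - (n + 1 : ℕ)) := by push_cast; rw [sub_sub]; ring

theorem sub_le_pow_mul (hu : HasBoundedRatios b u) (k : ℤ) (n : ℕ) :
    u (k - n) ≤ b ^ n * u k := by
  have h := hu.reflect.le_pow_mul_sub (-1 - (k - n)) n
  simpa only [BilateralShift.reflect, sub_sub_cancel,
    show -1 - (-1 - (k - n) - n) = k by ring] using h

end HasBoundedRatios

end Potential

section Contraction

variable {w u : ℤ → ℝ} {b : ℝ}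

/-- Uniform contraction on `s`. If `u` is a potential of `w`, then `‖B_w ^ n e_j‖ = u j / u (j - n)`
for the unit vectors `e_j`, so this says that these norms decay geometrically in `n`, uniformly in
`j ∈ s`. -/
def ContractsOn (u : ℤ → ℝ) (s : Set ℤ) : Prop :=
  ∃ C : ℝ, ∃ r ∈ Set.Ioo (0 : ℝ) 1, ∀ j ∈ s, ∀ n : ℕ, u j ≤ C * r ^ n * u (j - n)

section Ratio

variable {ι : Type*} {f : ι → ℤ}

theorem HasBoundedRatios.ratio_le (hu : HasBoundedRatios b u) (k : ℤ) (n : ℕ) :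
    u k / u (k - n) ≤ b ^ n :=
  (div_le_iff₀ (hu.pos _)).2 (hu.le_pow_mul_sub k n)

theorem HasBoundedRatios.le_ratio (hu : HasBoundedRatios b u) (k : ℤ) (n : ℕ) :
    b⁻¹ ^ n ≤ u k / u (k - n) := by
  have hb : 0 < b := hu.pos_bound
  rw [le_div_iff₀ (hu.pos _), inv_pow, inv_mul_le_iff₀ (by positivity)]
  exact hu.sub_le_pow_mul k n

theorem HasBoundedRatios.bddAbove_ratio (hu : HasBoundedRatios b u) (f : ι → ℤ) (n : ℕ) :
    BddAbove (Set.range fun k => u (f k) / u (f k - n)) := by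
  refine ⟨b ^ n, ?_⟩
  rintro _ ⟨k, rfl⟩
  exact hu.ratio_le (f k) n

variable [Nonempty ι]

theorem HasBoundedRatios.pow_le_iSup_ratio (hu : HasBoundedRatios b u) (f : ι → ℤ) (n : ℕ) :
    b⁻¹ ^ n ≤ ⨆ k, u (f k) / u (f k - n) :=
  (hu.le_ratio (f (Classical.arbitrary ι)) n).trans (le_ciSup (hu.bddAbove_ratio f n) _)

theorem HasBoundedRatios.iSup_ratio_add_le (hu : HasBoundedRatios b u)
    (hf : ∀ k (m : ℕ), f k - m ∈ Set.range f) (m n : ℕ) :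
    ⨆ k, u (f k) / u (f k - (m + n : ℕ)) ≤
      (⨆ k, u (f k) / u (f k - m)) * ⨆ k, u (f k) / u (f k - n) := by
  have hnonneg (k : ι) (n : ℕ) : 0 ≤ u (f k) / u (f k - n) := (div_pos (hu.pos _) (hu.pos _)).le
  refine ciSup_le fun k => ?_
  obtain ⟨k', hk'⟩ := hf k m
  calc u (f k) / u (f k - (m + n : ℕ)) = u (f k) / u (f k - m) * (u (f k') / u (f k' - n)) := by
        rw [hk', div_mul_div_cancel₀ (hu.pos _).ne', Nat.cast_add, sub_sub]
    _ ≤ _ := mul_le_mul (le_ciSup (hu.bddAbove_ratio f m) k) (le_ciSup (hu.bddAbove_ratio f n) k')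
        (hnonneg k' n) (Real.iSup_nonneg fun k => hnonneg k m)

theorem HasBoundedRatios.decaysGeometrically_iSup_ratio_iff (hu : HasBoundedRatios b u) :
    DecaysGeometrically (fun n => ⨆ k, u (f k) / u (f k - n)) ↔ ContractsOn u (Set.range f) := by
  unfold DecaysGeometrically ContractsOn
  simp only [Set.forall_mem_range, ← div_le_iff₀ (hu.pos _)]
  refine exists_congr fun C => exists_congr fun r => and_congr_right fun _ => ?_
  rw [forall_comm]
  exact forall_congr' fun n => ciSup_le_iff (hu.bddAbove_ratio f n)

theorem HasBoundedRatios.exists_tendsto_iSup_root_iff (hu : HasBoundedRatios b u)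
    (hf : ∀ k (m : ℕ), f k - m ∈ Set.range f) :
    (∃ L, Tendsto (fun n : ℕ => ⨆ k, (u (f k) / u (f k - (n + 1 : ℕ))) ^ (1 / (n : ℝ)))
      atTop (𝓝 L) ∧ L < 1) ↔ ContractsOn u (Set.range f) := by
  rw [← hu.decaysGeometrically_iSup_ratio_iff,
    ← exists_tendsto_root_lt_one_iff (inv_pos.2 hu.pos_bound) (hu.pow_le_iSup_ratio f)
      (hu.iSup_ratio_add_le hf)]
  refine exists_congr fun L => and_congr_left fun _ => tendsto_congr' ?_
  filter_upwards [eventually_ne_atTop 0] with n hn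
  exact iSup_root_eq (fun k => (div_pos (hu.pos _) (hu.pos _)).le) hn

theorem HasBoundedRatios.exists_tendsto_iInf_root_iff (hu : HasBoundedRatios b u)
    (hf : ∀ k (m : ℕ), f k - m ∈ Set.range f) :
    (∃ L, Tendsto (fun n : ℕ => ⨅ k, (u (f k - (n + 1 : ℕ)) / u (f k)) ^ (1 / (n : ℝ)))
      atTop (𝓝 L) ∧ 1 < L) ↔ ContractsOn u (Set.range f) := by
  rw [← hu.decaysGeometrically_iSup_ratio_iff,
    ← exists_tendsto_inv_root_gt_one_iff (inv_pos.2 hu.pos_bound) (hu.pow_le_iSup_ratio f)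
      (hu.iSup_ratio_add_le hf)]
  refine exists_congr fun L => and_congr_left fun _ => tendsto_congr' ?_
  filter_upwards [eventually_ne_atTop 0] with n hn
  have hpos (k : ι) : 0 < u (f k) / u (f k - (n + 1 : ℕ)) := div_pos (hu.pos _) (hu.pos _)
  have hbdd : BddAbove (Set.range fun k => (u (f k) / u (f k - (n + 1 : ℕ))) ^ (1 / (n : ℝ))) := by
    refine ⟨(b ^ (n + 1)) ^ (1 / (n : ℝ)), ?_⟩
    rintro _ ⟨k, rfl⟩
    exact Real.rpow_le_rpow (hpos k).le (hu.ratio_le (f k) (n + 1)) (by positivity)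
  rw [← iSup_root_eq (fun k => (hpos k).le) hn,
    ← iInf_inv_eq (fun k => Real.rpow_pos_of_pos (hpos k) _) hbdd]
  exact iInf_congr fun k => by rw [← Real.inv_rpow (hpos k).le, inv_div]

end Ratio

namespace IsPotential

theorem prod_forward_eq (hu : IsPotential w u) (k : ℤ) (n : ℕ) :
    ∏ i ∈ Finset.range n, w (k + i) = u (k + n - 1) / u (k - 1) := by
  rw [eq_div_iff (hu.pos _).ne']
  induction n with
  | zero => simp
  | succ n ih =>
    rw [Finset.prod_range_succ, mul_right_comm, ih, mul_comm, ← hu.eq_mul]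
    congr 1
    push_cast
    ring

theorem prod_backward_eq (hu : IsPotential w u) (k : ℤ) (n : ℕ) :
    ∏ i ∈ Finset.range n, w (k - i) = u k / u (k - n) := by
  rw [eq_div_iff (hu.pos _).ne']
  induction n with
  | zero => simp
  | succ n ih =>
    rw [Finset.prod_range_succ, ← ih, mul_assoc, Nat.cast_succ, ← sub_sub, ← hu.eq_mul]

theorem forwardMean_sub_eq (hu : IsPotential w u) (k : ℤ) (n : ℕ) :
    forwardMean w (k - n) n = (u k / u (k - (n + 1 : ℕ))) ^ (1 / (n : ℝ)) := by
  rw [forwardMean, hu.prod_forward_eq]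
  congr 3 <;> push_cast <;> ring

theorem forwardMean_eq_reflect (hu : IsPotential w u) (k : ℤ) (n : ℕ) :
    forwardMean w k n =
      (reflect u (-k - (n + 1 : ℕ)) / reflect u (-k)) ^ (1 / (n : ℝ)) := by
  rw [forwardMean, hu.prod_forward_eq]
  unfold reflect
  congr 3 <;> push_cast <;> ring

theorem backwardMean_eq (hu : IsPotential w u) (k : ℤ) (n : ℕ) :
    backwardMean w k n = (u k / u (k - (n + 1 : ℕ))) ^ (1 / (n : ℝ)) := by
  rw [backwardMean, hu.prod_backward_eq]

theorem conditionA_iff (hu : IsPotential w u) (hb : HasBoundedRatios b u) :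
    ConditionA w ↔ ContractsOn u Set.univ := by
  have h := hb.exists_tendsto_iSup_root_iff (f := id) fun k m => ⟨k - m, rfl⟩
  rw [Set.range_id] at h
  rw [← h]
  refine exists_congr fun L => and_congr_left fun _ => tendsto_congr fun n => ?_
  rw [← (Equiv.subRight (n : ℤ)).iSup_comp]
  exact iSup_congr fun k => hu.forwardMean_sub_eq k n

theorem conditionB_iff (hu : IsPotential w u) (hb : HasBoundedRatios b u) :
    ConditionB w ↔ ContractsOn (reflect u) Set.univ := by
  have h := hb.reflect.exists_tendsto_iInf_root_iff (f := fun k : ℤ => -k)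
    fun k m => ⟨k + m, by ring⟩
  rw [neg_surjective.range_eq] at h
  simp only [ConditionB, hu.forwardMean_eq_reflect, h]

theorem conditionC_iff (hu : IsPotential w u) (hb : HasBoundedRatios b u) :
    ConditionC w ↔ ContractsOn u (Set.Iio 0) ∧ ContractsOn (reflect u) (Set.Iio 0) := by
  have hrange : Set.range (fun k : ℕ+ => -((k : ℕ) : ℤ)) = Set.Iio 0 := by
    ext j
    refine ⟨?_, fun hj => ⟨⟨(-j).toNat, by have := Set.mem_Iio.1 hj; omega⟩, ?_⟩⟩
    · rintro ⟨k, rfl⟩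
      simp
    · have := Set.mem_Iio.1 hj
      simp only [PNat.mk_coe]; omega
  have hf (k : ℕ+) (m : ℕ) : -((k : ℕ) : ℤ) - m ∈ Set.range fun k : ℕ+ => -((k : ℕ) : ℤ) :=
    ⟨⟨k + m, by positivity⟩, by simp only [PNat.mk_coe]; push_cast; ring⟩
  have hA := hb.exists_tendsto_iSup_root_iff hf
  have hB := hb.reflect.exists_tendsto_iInf_root_iff hf
  rw [hrange] at hA hB
  simp only [ConditionC, hu.backwardMean_eq, hu.forwardMean_eq_reflect, hA, hB]

end IsPotential

end Contraction

section Supersolution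

variable {u v : ℤ → ℝ} {b δ : ℝ} {s t : Set ℤ}

theorem ContractsOn.mono (h : ContractsOn u t) (hst : s ⊆ t) : ContractsOn u s :=
  let ⟨C, r, hr, hC⟩ := h
  ⟨C, r, hr, fun j hj => hC j (hst hj)⟩

theorem contractsOn_empty (u : ℤ → ℝ) : ContractsOn u ∅ :=
  ⟨0, 1 / 2, by norm_num, fun _ hj => hj.elim⟩

theorem ContractsOn.preimage_sub (hu : HasBoundedRatios b u) (h : ContractsOn u s) (d : ℕ) :
    ContractsOn u {k | k - d ∈ s} := by
  obtain ⟨C, r, hr, hC⟩ := h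
  refine ⟨b ^ d * C * b ^ d, r, hr, fun k hk n => ?_⟩
  have hb : 0 < b := hu.pos_bound
  have hCr : 0 < C * r ^ n :=
    pos_of_mul_pos_left ((hu.pos _).trans_le (hC (k - d) hk n)) (hu.pos _).le
  calc u k ≤ b ^ d * u (k - d) := hu.le_pow_mul_sub k d
    _ ≤ b ^ d * (C * r ^ n * u (k - d - n)) := by gcongr; exact hC (k - d) hk n
    _ = b ^ d * (C * r ^ n * u (k - n - d)) := by rw [sub_right_comm]
    _ ≤ b ^ d * (C * r ^ n * (b ^ d * u (k - n))) := by gcongr; exact hu.sub_le_pow_mul (k - n) d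
    _ = b ^ d * C * b ^ d * r ^ n * u (k - n) := by ring

theorem ContractsOn.of_Iio (hu : HasBoundedRatios b u) {q : ℤ} (h : ContractsOn u (Set.Iio q))
    (q' : ℤ) : ContractsOn u (Set.Iio q') :=
  (h.preimage_sub hu (q' - q).toNat).mono fun k hk => by
    have := Set.mem_Iio.1 hk
    simp only [Set.mem_Iio, Set.mem_ofPred_eq]
    omega

/-- A sequence `v` dominated by `u` that decreases along `ℤ` at the rate `δ u`. For a potential `u`
of `w`, writing `v = u c` turns the inequality into `w j * c j + δ ≤ c (j - 1)`, which is what is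
left of a bounded solution of the perturbed shift equation. -/
structure IsSupersolution (δ : ℝ) (u v : ℤ → ℝ) : Prop where
  abs_le : ∀ j, |v j| ≤ u j
  add_le_pred : ∀ j, v j + δ * u (j - 1) ≤ v (j - 1)

namespace IsSupersolution

theorem neg_reflect (hu : HasBoundedRatios b u) (hδ : 0 ≤ δ) (h : IsSupersolution δ u v) :
    IsSupersolution (δ / b) (reflect u) (-reflect v) where
  abs_le j := by rw [Pi.neg_apply, abs_neg]; exact h.abs_le _
  add_le_pred j := by
    have hle : δ / b * u (-j) ≤ δ * u (-j - 1) := by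
      rw [div_mul_eq_mul_div, div_le_iff₀ hu.pos_bound, mul_assoc]
      exact mul_le_mul_of_nonneg_left ((hu.le_mul_pred (-j)).trans_eq (mul_comm _ _)) hδ
    have := h.add_le_pred (-j)
    simp only [Pi.neg_apply, reflect, show -1 - (j - 1) = -j by ring,
      show -1 - j = -j - 1 by ring]
    linarith

theorem antitone (hu : ∀ j, 0 < u j) (hδ : 0 ≤ δ) (h : IsSupersolution δ u v) : Antitone v :=
  antitone_int_of_succ_le fun j => by
    have := h.add_le_pred (j + 1)
    rw [add_sub_cancel_right] at this
    linarith [mul_nonneg hδ (hu j).le]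

theorem pow_mul_le_sub (hu : ∀ j, 0 < u j) (hδ : 0 ≤ δ) (h : IsSupersolution δ u v) (j : ℤ)
    (n : ℕ) : (1 + δ) ^ n * v j ≤ v (j - n) := by
  have hstep (j : ℤ) : (1 + δ) * v j ≤ v (j - 1) := by
    have hle : v j ≤ u (j - 1) :=
      (h.antitone hu hδ (by omega)).trans ((le_abs_self _).trans (h.abs_le (j - 1)))
    linarith [h.add_le_pred j, mul_le_mul_of_nonneg_left hle hδ]
  induction n with
  | zero => simp
  | succ n ih =>
    calc (1 + δ) ^ (n + 1) * v j = (1 + δ) * ((1 + δ) ^ n * v j) := by ring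
      _ ≤ (1 + δ) * v (j - n) := mul_le_mul_of_nonneg_left ih (by positivity)
      _ ≤ v (j - n - 1) := hstep _
      _ = v (j - (n + 1 : ℕ)) := by rw [Nat.cast_succ, sub_sub]

theorem contractsOn (hu : ∀ j, 0 < u j) (hδ : 0 < δ) (h : IsSupersolution δ u v) :
    ContractsOn u {j | 0 ≤ v (j + 1)} := by
  refine ⟨δ⁻¹, (1 + δ)⁻¹, ⟨by positivity, inv_lt_one_of_one_lt₀ (by linarith)⟩,
    fun j hj n => ?_⟩
  have hδu : δ * u j ≤ v j := by
    have := h.add_le_pred (j + 1)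
    rw [add_sub_cancel_right] at this
    linarith [show 0 ≤ v (j + 1) from hj]
  rw [inv_pow, ← mul_inv, ← div_eq_inv_mul, le_div_iff₀ (by positivity)]
  calc u j * (δ * (1 + δ) ^ n) = (1 + δ) ^ n * (δ * u j) := by ring
    _ ≤ (1 + δ) ^ n * v j := by gcongr
    _ ≤ v (j - n) := h.pow_mul_le_sub hu hδ.le j n
    _ ≤ u (j - n) := (le_abs_self _).trans (h.abs_le _)

theorem contractsOn_Iio (hu : HasBoundedRatios b u) (hδ : 0 < δ) (h : IsSupersolution δ u v)
    {q : ℤ} (hq : 0 ≤ v q) (q' : ℤ) : ContractsOn u (Set.Iio q') :=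
  ((h.contractsOn hu.pos hδ).mono fun _ hj =>
    hq.trans (h.antitone hu.pos hδ.le (Int.add_one_le_of_lt hj))).of_Iio hu q'

theorem trichotomy (hu : HasBoundedRatios b u) (hδ : 0 < δ) (h : IsSupersolution δ u v) :
    ContractsOn u Set.univ ∨ ContractsOn (reflect u) Set.univ ∨
      ContractsOn u (Set.Iio 0) ∧ ContractsOn (reflect u) (Set.Iio 0) := by
  have h' := h.neg_reflect hu hδ.le
  have hδ' : 0 < δ / b := div_pos hδ hu.pos_bound
  by_cases hpos : ∀ j, 0 ≤ v j
  · exact .inl ((h.contractsOn hu.pos hδ).mono fun j _ => hpos (j + 1))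
  by_cases hneg : ∀ j, v j ≤ 0
  · exact .inr (.inl ((h'.contractsOn hu.reflect.pos hδ').mono fun j _ =>
      neg_nonneg.2 (hneg _)))
  push Not at hpos hneg
  obtain ⟨p, hp⟩ := hpos
  obtain ⟨q, hq⟩ := hneg
  refine .inr (.inr ⟨h.contractsOn_Iio hu hδ hq.le 0,
    h'.contractsOn_Iio hu.reflect hδ' (q := -1 - p) ?_ 0⟩)
  rw [Pi.neg_apply, reflect, sub_sub_cancel]
  exact neg_nonneg.2 hp.le

end IsSupersolution

end Supersolution

theorem semiconj_zpow {X Y : Type*} [TopologicalSpace X] [TopologicalSpace Y] {R : X ≃ₜ X}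
    {S : Y ≃ₜ Y} {h : X → Y} (hRS : Function.Semiconj h R S) (n : ℤ) :
    Function.Semiconj h (R ^ n : X ≃ₜ X) (S ^ n : Y ≃ₜ Y) := by
  have hinv : Function.Semiconj h (R⁻¹ : X ≃ₜ X) (S⁻¹ : Y ≃ₜ Y) :=
    hRS.inverses_right R.apply_symm_apply S.symm_apply_apply
  induction n using Int.induction_on with
  | zero => exact Function.Semiconj.id_right
  | succ n ih => rw [zpow_add_one, zpow_add_one]; exact ih.comp_right hRS
  | pred n ih => rw [zpow_sub_one, zpow_sub_one]; exact ih.comp_right hinv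

section GreenKernel

variable {𝕜 E : Type*} [NontriviallyNormedField 𝕜] [NormedAddCommGroup E] [NormedSpace 𝕜 E]
variable {T : E →L[𝕜] E} {G : ℤ → E →L[𝕜] E} {S S' : E ≃ₜ E} {f g : E →ᵇ E} {δ : ℝ≥0}

/-- A summable fundamental solution of the difference equation `x (m + 1) = T (x m) + f m` on `ℤ`:
convolving the inhomogeneity `f` with `G` solves the equation. -/
structure IsGreenKernel (T : E →L[𝕜] E) (G : ℤ → E →L[𝕜] E) : Prop where
  summable_norm : Summable fun m => ‖G m‖
  apply_eq : ∀ m x, G m x = T (G (m - 1) x) + if m = 0 then x else 0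

/-- The map `x ↦ x + θ x`. -/
def idAdd (θ : E →ᵇ E) : C(E, E) := ⟨fun x => x + θ x, continuous_id.add θ.continuous⟩

theorem idAdd_apply (θ : E →ᵇ E) (x : E) : idAdd θ x = x + θ x := rfl

theorem idAdd_zero : idAdd (0 : E →ᵇ E) = ContinuousMap.id E :=
  ContinuousMap.ext fun x => add_zero x

theorem norm_comp_idAdd_sub_le (hf : LipschitzWith δ f) (θ η : E →ᵇ E) :
    ‖f.compContinuous (idAdd θ) - f.compContinuous (idAdd η)‖ ≤ δ * ‖θ - η‖ := by
  refine (BoundedContinuousFunction.norm_le (by positivity)).2 fun x => ?_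
  calc ‖f (x + θ x) - f (x + η x)‖ ≤ δ * ‖(x + θ x) - (x + η x)‖ := hf.norm_sub_le _ _
    _ = δ * ‖(θ - η) x‖ := by rw [add_sub_add_left_eq_sub, BoundedContinuousFunction.sub_apply]
    _ ≤ δ * ‖θ - η‖ := by gcongr; exact (θ - η).norm_coe_le_norm x

namespace IsGreenKernel

theorem norm_apply_le (G : ℤ → E →L[𝕜] E) (S : E ≃ₜ E) (f : E →ᵇ E) (x : E) (m : ℤ) :
    ‖G m (f ((S ^ (-m - 1)) x))‖ ≤ ‖G m‖ * ‖f‖ :=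
  (G m).le_opNorm_of_le (f.norm_coe_le_norm _)

variable [CompleteSpace E]

/-- The solution operator `f ↦ θ` of the cohomological equation `θ ∘ S = T ∘ θ + f`, obtained by
convolving the values of `f` along the orbits of `S` with the Green kernel. -/
noncomputable def greenOperator (hG : IsGreenKernel T G) (S : E ≃ₜ E) (f : E →ᵇ E) : E →ᵇ E :=
  .ofNormedAddCommGroup (fun x => ∑' m, G m (f ((S ^ (-m - 1)) x)))
    (continuous_tsum (fun m => (G m).continuous.comp (f.continuous.comp (S ^ (-m - 1)).continuous))
      (hG.summable_norm.mul_right ‖f‖) fun m x => norm_apply_le G S f x m)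
    ((∑' m, ‖G m‖) * ‖f‖)
    fun x => tsum_of_norm_bounded (hG.summable_norm.hasSum.mul_right ‖f‖) (norm_apply_le G S f x)

variable (hG : IsGreenKernel T G)
include hG

theorem summable_apply (S : E ≃ₜ E) (f : E →ᵇ E) (x : E) :
    Summable fun m => G m (f ((S ^ (-m - 1)) x)) :=
  .of_norm_bounded (hG.summable_norm.mul_right ‖f‖) (norm_apply_le G S f x)

theorem greenOperator_apply (S : E ≃ₜ E) (f : E →ᵇ E) (x : E) :
    hG.greenOperator S f x = ∑' m, G m (f ((S ^ (-m - 1)) x)) := rfl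

theorem norm_greenOperator_le (S : E ≃ₜ E) (f : E →ᵇ E) :
    ‖hG.greenOperator S f‖ ≤ (∑' m, ‖G m‖) * ‖f‖ :=
  BoundedContinuousFunction.norm_ofNormedAddCommGroup_le _
    (mul_nonneg (tsum_nonneg fun _ => norm_nonneg _) (norm_nonneg f)) _

theorem greenOperator_add (S : E ≃ₜ E) (f g : E →ᵇ E) :
    hG.greenOperator S (f + g) = hG.greenOperator S f + hG.greenOperator S g := by
  ext x
  simp only [BoundedContinuousFunction.add_apply, greenOperator_apply, map_add]
  exact (hG.summable_apply S f x).tsum_add (hG.summable_apply S g x)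

theorem greenOperator_sub (S : E ≃ₜ E) (f g : E →ᵇ E) :
    hG.greenOperator S (f - g) = hG.greenOperator S f - hG.greenOperator S g := by
  rw [eq_sub_iff_add_eq, ← hG.greenOperator_add, sub_add_cancel]

theorem greenOperator_apply_map (S : E ≃ₜ E) (f : E →ᵇ E) (x : E) :
    hG.greenOperator S f (S x) = T (hG.greenOperator S f x) + f x := by
  have horbit (m : ℤ) : (S ^ (-m - 1)) (S x) = (S ^ (-(m - 1) - 1)) x := by
    rw [← Homeomorph.mul_apply, ← zpow_add_one]
    congr 2
    ring
  have hsum : Summable fun m : ℤ => T (G (m - 1) (f ((S ^ (-(m - 1) - 1)) x))) :=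
    ((Equiv.subRight 1).summable_iff.2 (hG.summable_apply S f x)).mapL T
  calc hG.greenOperator S f (S x)
      = ∑' m : ℤ, (T (G (m - 1) (f ((S ^ (-(m - 1) - 1)) x))) + if m = 0 then f x else 0) := by
        refine tsum_congr fun m => ?_
        rw [horbit, hG.apply_eq m]
        split_ifs with hm <;> simp [hm]
    _ = ∑' m : ℤ, T (G (m - 1) (f ((S ^ (-(m - 1) - 1)) x))) + f x := by
        rw [hsum.tsum_add (hasSum_ite_eq 0 (f x)).summable, tsum_ite_eq]
    _ = T (hG.greenOperator S f x) + f x := by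
        rw [hG.greenOperator_apply, T.map_tsum (hG.summable_apply S f x)]
        congr 1
        exact (Equiv.subRight (1 : ℤ)).tsum_eq fun m => T (G m (f ((S ^ (-m - 1)) x)))

theorem greenOperator_comp {h : C(E, E)} (hSS' : Function.Semiconj h S S') (f : E →ᵇ E) (x : E) :
    hG.greenOperator S' f (h x) = hG.greenOperator S (f.compContinuous h) x :=
  tsum_congr fun m => by
    rw [BoundedContinuousFunction.compContinuous_apply, (semiconj_zpow hSS' (-m - 1)).eq]

theorem norm_greenOperator_comp_idAdd_sub_le (S : E ≃ₜ E) (hg : LipschitzWith δ g)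
    (θ η : E →ᵇ E) :
    ‖hG.greenOperator S (g.compContinuous (idAdd θ)) -
      hG.greenOperator S (g.compContinuous (idAdd η))‖ ≤ (∑' m, ‖G m‖) * δ * ‖θ - η‖ := by
  rw [← hG.greenOperator_sub, mul_assoc]
  exact (hG.norm_greenOperator_le S _).trans (mul_le_mul_of_nonneg_left
    (norm_comp_idAdd_sub_le hg θ η) (tsum_nonneg fun _ => norm_nonneg _))

theorem exists_eq_greenOperator_comp_sub (S : E ≃ₜ E) (f : E →ᵇ E) (hg : LipschitzWith δ g)
    (hδ : (∑' m, ‖G m‖) * δ < 1) :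
    ∃ θ : E →ᵇ E, θ = hG.greenOperator S (g.compContinuous (idAdd θ) - f) := by
  have hK : 0 ≤ (∑' m, ‖G m‖) * δ := mul_nonneg (tsum_nonneg fun _ => norm_nonneg _) δ.2
  have hcontr : ContractingWith ⟨(∑' m, ‖G m‖) * δ, hK⟩
      fun θ : E →ᵇ E => hG.greenOperator S (g.compContinuous (idAdd θ) - f) := by
    refine ⟨hδ, .of_dist_le_mul fun θ η => ?_⟩
    rw [dist_eq_norm, dist_eq_norm, hG.greenOperator_sub, hG.greenOperator_sub,
      sub_sub_sub_cancel_right]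
    exact hG.norm_greenOperator_comp_idAdd_sub_le S hg θ η
  exact ⟨_, hcontr.fixedPoint_isFixedPt.symm⟩

theorem semiconj_idAdd (hS : ∀ x, S x = T x + f x) (hS' : ∀ x, S' x = T x + g x) {θ : E →ᵇ E}
    (hθ : θ = hG.greenOperator S (g.compContinuous (idAdd θ) - f)) :
    Function.Semiconj (idAdd θ) S S' := fun x => by
  have h := hG.greenOperator_apply_map S (g.compContinuous (idAdd θ) - f) x
  rw [← hθ, BoundedContinuousFunction.sub_apply,
    BoundedContinuousFunction.compContinuous_apply, idAdd_apply] at h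
  rw [idAdd_apply, idAdd_apply, hS', h, hS, T.map_add]
  abel

/-- Uniqueness of the displacement conjugating `S` to itself: it is a fixed point of a contraction
that also fixes `0`. -/
theorem leftInverse_idAdd (hS : ∀ x, S x = T x + f x) (hS' : ∀ x, S' x = T x + g x)
    (hf : LipschitzWith δ f) (hδ : (∑' m, ‖G m‖) * δ < 1) {θ θ' : E →ᵇ E}
    (hθ : θ = hG.greenOperator S (g.compContinuous (idAdd θ) - f))
    (hθ' : θ' = hG.greenOperator S' (f.compContinuous (idAdd θ') - g)) :
    Function.LeftInverse (idAdd θ') (idAdd θ) := by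
  set χ : E →ᵇ E := θ + θ'.compContinuous (idAdd θ)
  have hcomp (x : E) : idAdd θ' (idAdd θ x) = idAdd χ x := add_assoc _ _ _
  have hθ'comp : θ'.compContinuous (idAdd θ) =
      hG.greenOperator S ((f.compContinuous (idAdd θ') - g).compContinuous (idAdd θ)) := by
    ext x
    exact (DFunLike.congr_fun hθ' (idAdd θ x)).trans
      (hG.greenOperator_comp (hG.semiconj_idAdd hS hS' hθ) _ x)
  have hfix : χ = hG.greenOperator S (f.compContinuous (idAdd χ)) -
      hG.greenOperator S (f.compContinuous (idAdd 0)) := by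
    rw [← hG.greenOperator_sub]
    refine (congrArg₂ (· + ·) hθ hθ'comp).trans ?_
    rw [← hG.greenOperator_add, idAdd_zero]
    congr 1
    ext x
    change (g (idAdd θ x) - f x) + (f (idAdd θ' (idAdd θ x)) - g (idAdd θ x)) =
      f (idAdd χ x) - f x
    rw [hcomp]
    abel
  have hzero : χ = 0 := by
    by_contra hne
    have hle := hG.norm_greenOperator_comp_idAdd_sub_le S hf χ 0
    rw [← hfix, sub_zero] at hle
    exact hle.not_gt (mul_lt_of_lt_one_left (norm_pos_iff.2 hne) hδ)
  intro x
  rw [hcomp, hzero, idAdd_zero, ContinuousMap.id_apply]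

theorem exists_homeomorph_semiconj (hS : ∀ x, S x = T x + f x) (hS' : ∀ x, S' x = T x + g x)
    (hf : LipschitzWith δ f) (hg : LipschitzWith δ g) (hδ : (∑' m, ‖G m‖) * δ < 1) :
    ∃ θ : E →ᵇ E, ‖θ‖ ≤ (∑' m, ‖G m‖) * (‖f‖ + ‖g‖) ∧ IsHomeomorph (fun x => x + θ x) ∧
      Function.Semiconj (fun x => x + θ x) S S' := by
  obtain ⟨θ, hθ⟩ := hG.exists_eq_greenOperator_comp_sub S f hg hδ
  obtain ⟨θ', hθ'⟩ := hG.exists_eq_greenOperator_comp_sub S' g hf hδ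
  refine ⟨θ, ?_, ?_, hG.semiconj_idAdd hS hS' hθ⟩
  · have hg_le : ‖g.compContinuous (idAdd θ)‖ ≤ ‖g‖ :=
      (BoundedContinuousFunction.norm_le (norm_nonneg g)).2 fun x => g.norm_coe_le_norm _
    rw [hθ, add_comm]
    exact (hG.norm_greenOperator_le S _).trans (mul_le_mul_of_nonneg_left
      ((norm_sub_le _ _).trans (add_le_add_left hg_le _)) (tsum_nonneg fun _ => norm_nonneg _))
  · exact isHomeomorph_iff_exists_inverse.2 ⟨(idAdd θ).continuous, idAdd θ',
      hG.leftInverse_idAdd hS hS' hf hδ hθ hθ', hG.leftInverse_idAdd hS' hS hg hδ hθ' hθ,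
      (idAdd θ').continuous⟩

end IsGreenKernel

theorem exists_homeomorph_eq_add [CompleteSpace E] (T : E ≃L[𝕜] E) {α : E → E}
    (hα : LipschitzWith δ α) (hδ : Subsingleton E ∨ δ < ‖(T.symm : E →L[𝕜] E)‖₊⁻¹) :
    ∃ S : E ≃ₜ E, ∀ x, S x = T x + α x := by
  have happ : ApproximatesLinearOn (fun x => T x + α x) (T : E →L[𝕜] E) Set.univ δ := by
    rw [ApproximatesLinearOn.approximatesLinearOn_iff_lipschitzOnWith, lipschitzOnWith_univ]
    convert hα using 2
    exact funext fun x => add_sub_cancel_left (T x) (α x)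
  exact ⟨happ.toHomeomorph _ hδ, fun _ => rfl⟩

theorem eventually_lt_inv_nnnorm_symm (T : E ≃L[𝕜] E) :
    ∀ᶠ δ : ℝ≥0 in 𝓝[>] 0, Subsingleton E ∨ δ < ‖(T.symm : E →L[𝕜] E)‖₊⁻¹ := by
  rcases subsingleton_or_nontrivial E with hE | hE
  · exact .of_forall fun _ => .inl hE
  · exact (eventually_nhdsWithin_of_eventually_nhds
      (eventually_lt_nhds (inv_pos.2 T.nnnorm_symm_pos))).mono fun _ => .inr

theorem IsGreenKernel.stronglyStructurallyStable [CompleteSpace E] (T : E ≃L[𝕜] E)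
    (hG : IsGreenKernel (T : E →L[𝕜] E) G) : StronglyStructurallyStable T := by
  intro ε hε
  have hK : Tendsto (fun δ : ℝ≥0 => (∑' m, ‖G m‖) * δ) (𝓝[>] 0) (𝓝 0) :=
    ((NNReal.continuous_coe.const_mul _).tendsto' 0 0 (by simp)).mono_left nhdsWithin_le_nhds
  obtain ⟨δ, ⟨⟨hδT, hδ1⟩, hδε⟩, hδ0⟩ := (((eventually_lt_inv_nnnorm_symm T).and
    (hK.eventually_lt_const one_pos)).and (hK.eventually_lt_const hε)).and
    self_mem_nhdsWithin |>.exists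
  refine ⟨δ, hδ0, fun α hα hα_lip => ?_⟩
  have hlip : LipschitzWith δ α := .of_dist_le_mul fun x y => by
    simpa only [dist_eq_norm] using hα_lip x y
  obtain ⟨S, hS⟩ := exists_homeomorph_eq_add T hlip hδT
  set f : E →ᵇ E := .ofNormedAddCommGroup α hlip.continuous δ hα
  obtain ⟨φ, hφ, hhomeo, hsemi⟩ := hG.exists_homeomorph_semiconj (f := f) (g := 0)
    (S' := T.toHomeomorph) hS (fun x => (add_zero (T x)).symm) hlip
    (LipschitzWith.const' (0 : E)) hδ1
  refine ⟨φ, fun x => (φ.norm_coe_le_norm x).trans (hφ.trans ?_), hhomeo, fun x => ?_⟩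
  · rw [norm_zero, add_zero]
    refine (mul_le_mul_of_nonneg_left ?_ (tsum_nonneg fun _ => norm_nonneg _)).trans hδε.le
    exact BoundedContinuousFunction.norm_ofNormedAddCommGroup_le _ δ.2 hα
  · rw [← hS]
    exact (hsemi x).symm

end GreenKernel

section Interpolation

variable {X E ι : Type*} [PseudoMetricSpace X] [NormedAddCommGroup E] [NormedSpace ℝ E] [Fintype ι]
variable {R δ : ℝ} {y : ι → X} {e : ι → E}

/-- The tent function of height one and radius `R` centred at `y`. -/
noncomputable def tent (R : ℝ) (y x : X) : ℝ := max (1 - dist x y / R) 0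

theorem tent_nonneg (R : ℝ) (y x : X) : 0 ≤ tent R y x := le_max_right _ _

theorem tent_le_one (hR : 0 ≤ R) (y x : X) : tent R y x ≤ 1 :=
  max_le (sub_le_self _ (by positivity)) zero_le_one

theorem tent_self (R : ℝ) (y : X) : tent R y y = 1 := by simp [tent]

theorem tent_eq_zero (hR : 0 < R) {y x : X} (h : R ≤ dist x y) : tent R y x = 0 :=
  max_eq_right (sub_nonpos.2 ((one_le_div hR).2 h))

theorem abs_tent_sub_tent_le (hR : 0 < R) (y x x' : X) :
    |tent R y x - tent R y x'| ≤ dist x x' / R := by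
  refine (abs_max_sub_max_le_abs _ _ _).trans ?_
  rw [sub_sub_sub_cancel_left, ← sub_div, abs_div, abs_of_pos hR, dist_comm x x']
  gcongr
  exact abs_dist_sub_le x' x y

theorem sum_tent_smul_eq (hR : 0 < R) (hy : Pairwise fun i j => 2 * R ≤ dist (y i) (y j))
    (e : ι → E) {i : ι} {x : X} (hx : dist x (y i) < R) :
    ∑ j, tent R (y j) x • e j = tent R (y i) x • e i := by
  refine Fintype.sum_eq_single i fun j hji => ?_
  have hfar : R ≤ dist x (y j) := by linarith [hy hji, dist_triangle_left (y j) (y i) x]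
  rw [tent_eq_zero hR hfar, zero_smul]

theorem norm_sum_tent_smul_le (hR : 0 < R) (hy : Pairwise fun i j => 2 * R ≤ dist (y i) (y j))
    (hδ : 0 ≤ δ) (he : ∀ i, ‖e i‖ ≤ δ) (x : X) : ‖∑ i, tent R (y i) x • e i‖ ≤ δ := by
  by_cases! hx : ∃ i, dist x (y i) < R
  · obtain ⟨i, hi⟩ := hx
    rw [sum_tent_smul_eq hR hy e hi, norm_smul, Real.norm_of_nonneg (tent_nonneg _ _ _)]
    exact (mul_le_of_le_one_left (norm_nonneg _) (tent_le_one hR.le _ _)).trans (he i)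
  · rwa [Finset.sum_eq_zero fun i _ => by rw [tent_eq_zero hR (hx i), zero_smul], norm_zero]

theorem norm_sum_tent_smul_sub_le (hR : 0 < R) (hcard : Fintype.card ι ≤ R) (hδ : 0 ≤ δ)
    (he : ∀ i, ‖e i‖ ≤ δ) (x x' : X) :
    ‖∑ i, tent R (y i) x • e i - ∑ i, tent R (y i) x' • e i‖ ≤ δ * dist x x' := by
  rw [← Finset.sum_sub_distrib]
  calc ‖∑ i, (tent R (y i) x • e i - tent R (y i) x' • e i)‖
      ≤ ∑ _i : ι, dist x x' / R * δ := by
        refine norm_sum_le_of_le _ fun i _ => ?_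
        rw [← sub_smul, norm_smul]
        exact mul_le_mul (abs_tent_sub_tent_le hR _ _ _) (he i) (norm_nonneg _) (by positivity)
    _ = Fintype.card ι / R * (δ * dist x x') := by
        rw [Finset.sum_const, Finset.card_univ, nsmul_eq_mul]
        ring
    _ ≤ δ * dist x x' := mul_le_of_le_one_left (by positivity) ((div_le_one hR).2 hcard)

theorem exists_lipschitz_interpolation (hR : 0 < R) (hcard : Fintype.card ι ≤ R)
    (hy : Pairwise fun i j => 2 * R ≤ dist (y i) (y j)) (hδ : 0 ≤ δ) (he : ∀ i, ‖e i‖ ≤ δ) :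
    ∃ α : X → E, (∀ x, ‖α x‖ ≤ δ) ∧ (∀ x x', ‖α x - α x'‖ ≤ δ * dist x x') ∧
      ∀ i, α (y i) = e i := by
  refine ⟨fun x => ∑ i, tent R (y i) x • e i, norm_sum_tent_smul_le hR hy hδ he,
    norm_sum_tent_smul_sub_le hR hcard hδ he, fun i => ?_⟩
  have hi : dist (y i) (y i) < R := by rwa [dist_self]
  exact (sum_tent_smul_eq hR hy e hi).trans (by rw [tent_self, one_smul])

end Interpolation

section Shadowing

variable {E F : Type*} [NormedAddCommGroup E] [NormedSpace ℝ E] [FunLike F E E]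
  [AddMonoidHomClass F E E]

theorem eventually_pairwise_le_dist_nsmul_add {ι : Type*} [Finite ι] {x : ι → E}
    (hx : Function.Injective x) (q : ι → E) (R : ℝ) :
    ∀ᶠ k : ℕ in atTop, Pairwise fun i j => R ≤ dist (k • x i + q i) (k • x j + q j) := by
  refine eventually_all.2 fun i => eventually_all.2 fun j =>
    eventually_imp_distrib_left.2 fun h => ?_
  have hpos : 0 < ‖x i - x j‖ := norm_pos_iff.2 (sub_ne_zero.2 (hx.ne h))
  have hlim : Tendsto (fun k : ℕ => (k : ℝ) * ‖x i - x j‖ - ‖q j - q i‖) atTop atTop :=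
    tendsto_atTop_add_const_right _ _ (tendsto_natCast_atTop_atTop.atTop_mul_const hpos)
  filter_upwards [hlim.eventually_ge_atTop R] with k hk
  calc R ≤ k * ‖x i - x j‖ - ‖q j - q i‖ := hk
    _ = ‖k • (x i - x j)‖ - ‖q j - q i‖ := by rw [RCLike.norm_nsmul ℝ, nsmul_eq_mul]
    _ ≤ ‖k • (x i - x j) - (q j - q i)‖ := norm_sub_norm_le _ _
    _ = dist (k • x i + q i) (k • x j + q j) := by
        rw [dist_eq_norm, smul_sub]
        congr 1
        abel

/-- Realise the inhomogeneity by a perturbation along a widely spaced orbit and read off the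
conjugacy `I + φ` on that orbit. -/
theorem StronglyStructurallyStable.exists_bounded_solution {T : F}
    (hT : StronglyStructurallyStable T) :
    ∃ δ : ℝ, 0 < δ ∧ ∀ z : E, Function.Injective (fun n : ℕ => T^[n] z) →
      ∀ (N : ℕ) (e : ℕ → E), (∀ n, ‖e n‖ ≤ δ) →
        ∃ v : ℕ → E, (∀ n, ‖v n‖ ≤ 1) ∧ ∀ n < N, v (n + 1) = T (v n) + e n := by
  obtain ⟨δ, hδ, hT⟩ := hT 1 one_pos
  refine ⟨δ, hδ, fun z hz N e he => ?_⟩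
  obtain ⟨q, hq⟩ : ∃ q : ℕ → E, ∀ n, q (n + 1) = T (q n) + e n :=
    ⟨fun n => n.rec 0 fun n x => T x + e n, fun _ => rfl⟩
  obtain ⟨k, hk⟩ := (eventually_pairwise_le_dist_nsmul_add
    (hz.comp (Fin.val_injective (n := N))) (fun i => q i) (2 * (N + 1))).exists
  set y : ℕ → E := fun n => k • T^[n] z + q n with hy
  have hy_succ : ∀ n, y (n + 1) = T (y n) + e n := fun n => by
    simp only [hy, hq, map_add, map_nsmul, Function.iterate_succ_apply', add_assoc]
  obtain ⟨α, hα, hα_lip, hαy⟩ := exists_lipschitz_interpolation (y := fun i : Fin N => y i)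
    (by positivity) (by rw [Fintype.card_fin]; linarith) hk hδ.le fun i => he i
  obtain ⟨φ, hφ, -, hconj⟩ := hT α hα fun x x' => (hα_lip x x').trans_eq (by rw [dist_eq_norm])
  refine ⟨fun n => -φ (y n), fun n => (norm_neg _).trans_le (hφ _), fun n hn => ?_⟩
  have hconj_y : T (y n) + T (φ (y n)) = T (y n) + (e n + φ (y (n + 1))) := by
    rw [← map_add, hconj, hαy ⟨n, hn⟩, ← hy_succ, ← add_assoc, ← hy_succ]
  rw [map_neg, add_left_cancel hconj_y, neg_add_rev, neg_add_cancel_right]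

end Shadowing

theorem exists_bounded_solution_of_forall_window {w : ℤ → ℝ} {δ : ℝ}
    (h : ∀ N : ℕ, ∃ b : ℤ → ℝ, (∀ j, |b j| ≤ 1) ∧
      ∀ j ∈ Set.Icc (-N : ℤ) N, b (j - 1) = w j * b j + δ) :
    ∃ b : ℤ → ℝ, (∀ j, |b j| ≤ 1) ∧ ∀ j, b (j - 1) = w j * b j + δ := by
  choose b hb_le hb using h
  have hcompact : IsCompact (Set.univ.pi fun _ : ℤ => Set.Icc (-1 : ℝ) 1) :=
    isCompact_univ_pi fun _ => isCompact_Icc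
  obtain ⟨b', hb', φ, hφ, hlim⟩ := hcompact.tendsto_subseq fun N j _ => abs_le.1 (hb_le N j)
  rw [tendsto_pi_nhds] at hlim
  refine ⟨b', fun j => abs_le.2 (hb' j (Set.mem_univ j)), fun j => ?_⟩
  refine tendsto_nhds_unique_of_eventuallyEq (hlim (j - 1))
    (((hlim j).const_mul (w j)).add_const δ) ?_
  filter_upwards [eventually_ge_atTop j.natAbs] with N hN
  have hjN : j.natAbs ≤ φ N := hN.trans (hφ.le_apply)
  exact hb (φ N) j ⟨by omega, by omega⟩

section GreenCoeff

variable {w u : ℤ → ℝ} {s : Set ℤ}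

open Classical in
/-- The coefficients of the Green kernel of a weighted shift with potential `u`, acting by
`(G m x) n = greenCoeff u s m n * x (n + m)`. Mass at a coordinate in `s` is propagated forwards in
time, mass at a coordinate outside `s` backwards. -/
noncomputable def greenCoeff (u : ℤ → ℝ) (s : Set ℤ) (m n : ℤ) : ℝ :=
  ((if n + m ∈ s then 1 else 0) - if m < 0 then 1 else 0) * (u (n + m) / u n)

theorem IsPotential.greenCoeff_eq (hu : IsPotential w u) (s : Set ℤ) (m n : ℤ) :
    greenCoeff u s m n = w (n + 1) * greenCoeff u s (m - 1) (n + 1) + if m = 0 then 1 else 0 := by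
  have hn : u n ≠ 0 := (hu.pos n).ne'
  have hn' : u (n + 1) ≠ 0 := (hu.pos (n + 1)).ne'
  have hw : w (n + 1) = u (n + 1) / u n := by
    rw [eq_div_iff hn, hu.eq_mul (n + 1), add_sub_cancel_right]
  rw [greenCoeff, greenCoeff, hw, show n + 1 + (m - 1) = n + m by ring]
  rcases lt_trichotomy m 0 with hm | rfl | hm
  · rw [if_pos hm, if_pos (by omega : m - 1 < 0), if_neg hm.ne]
    field_simp
    ring
  · rw [if_neg (lt_irrefl 0), if_pos (by norm_num : (0 : ℤ) - 1 < 0), if_pos rfl, add_zero]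
    field_simp
    ring
  · rw [if_neg hm.not_gt, if_neg (by omega : ¬m - 1 < 0), if_neg hm.ne']
    field_simp
    ring

theorem abs_greenCoeff_of_nonneg (hu : ∀ n, 0 < u n) {m : ℤ} (hm : 0 ≤ m) (n : ℤ) :
    |greenCoeff u s m n| = s.indicator (fun j => u j / u (j - m)) (n + m) := by
  by_cases h : n + m ∈ s
  · rw [Set.indicator_of_mem h, greenCoeff, if_pos h, if_neg hm.not_gt, sub_zero, one_mul,
      add_sub_cancel_right, abs_of_pos (div_pos (hu _) (hu _))]
  · rw [Set.indicator_of_notMem h, greenCoeff, if_neg h, if_neg hm.not_gt, sub_zero, zero_mul,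
      abs_zero]

theorem abs_greenCoeff_of_neg (hu : ∀ n, 0 < u n) {m : ℤ} (hm : m < 0) (n : ℤ) :
    |greenCoeff u s m n| = sᶜ.indicator (fun j => u j / u (j - m)) (n + m) := by
  by_cases h : n + m ∈ s
  · rw [Set.indicator_of_notMem (not_not.2 h), greenCoeff, if_pos h, if_pos hm, sub_self, zero_mul,
      abs_zero]
  · rw [Set.indicator_of_mem h, greenCoeff, if_neg h, if_pos hm, zero_sub, neg_one_mul, abs_neg,
      add_sub_cancel_right, abs_of_pos (div_pos (hu _) (hu _))]

theorem summable_geometric_natAbs {r : ℝ} (hr : r ∈ Set.Ioo 0 1) :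
    Summable fun m : ℤ => r ^ m.natAbs :=
  have h : Summable fun n : ℕ => r ^ n := summable_geometric_of_lt_one hr.1.le hr.2
  .of_nat_of_neg (by simpa only [Int.natAbs_natCast] using h)
    (by simpa only [Int.natAbs_neg, Int.natAbs_natCast] using h)

theorem exists_summable_forall_abs_greenCoeff_le (hu : ∀ n, 0 < u n) (hs : ContractsOn u s)
    (hs' : ContractsOn (reflect u) {j | -1 - j ∉ s}) :
    ∃ a : ℤ → ℝ, Summable a ∧ ∀ m n, |greenCoeff u s m n| ≤ a m := by
  obtain ⟨C, r, hr, hC⟩ := hs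
  obtain ⟨C', r', hr', hC'⟩ := hs'
  have hpow {r : ℝ} (hr : r ∈ Set.Ioo 0 1) (m : ℤ) : 0 < r ^ m.natAbs := pow_pos hr.1 _
  refine ⟨fun m => |C| * r ^ m.natAbs + |C'| * r' ^ m.natAbs,
    ((summable_geometric_natAbs hr).mul_left _).add ((summable_geometric_natAbs hr').mul_left _),
    fun m n => ?_⟩
  have hnonneg := mul_nonneg (abs_nonneg C) (hpow hr m).le
  have hnonneg' := mul_nonneg (abs_nonneg C') (hpow hr' m).le
  rcases le_or_gt 0 m with hm | hm
  · rw [abs_greenCoeff_of_nonneg hu hm]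
    refine Set.indicator_le' (fun j hj => ?_) (fun _ _ => add_nonneg hnonneg hnonneg') _
    have h := hC j hj m.natAbs
    rw [Int.natAbs_of_nonneg hm, ← div_le_iff₀ (hu _)] at h
    linarith [mul_le_mul_of_nonneg_right (le_abs_self C) (hpow hr m).le]
  · rw [abs_greenCoeff_of_neg hu hm]
    refine Set.indicator_le' (fun j hj => ?_) (fun _ _ => add_nonneg hnonneg hnonneg') _
    have h := hC' (-1 - j) (by rwa [Set.mem_ofPred_eq, sub_sub_cancel]) m.natAbs
    rw [reflect, reflect, sub_sub_cancel, Int.ofNat_natAbs_of_nonpos hm.le,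
      show -1 - (-1 - j - -m) = j - m by ring, ← div_le_iff₀ (hu _)] at h
    linarith [mul_le_mul_of_nonneg_right (le_abs_self C') (hpow hr' m).le]

end GreenCoeff

section SequenceSpace

variable {𝕜 E : Type*} [RCLike 𝕜] [NormedAddCommGroup E] [NormedSpace 𝕜 E]
variable {c : E →ₗ[𝕜] ℤ → 𝕜} {w u : ℤ → ℝ} {s : Set ℤ}

/-- `c` is the coordinate map of a solid translation invariant space of sequences on `ℤ`, whose
unit vectors have norm at most one and whose coordinate functionals are contractions. -/
structure IsSequenceSpace (c : E →ₗ[𝕜] ℤ → 𝕜) : Prop where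
  injective : Function.Injective c
  norm_coord_le : ∀ x n, ‖c x n‖ ≤ ‖x‖
  exists_single : ∀ j, ∃ x, c x = Pi.single j 1 ∧ ‖x‖ ≤ 1
  exists_of_le : ∀ {C : ℝ}, 0 ≤ C → ∀ (f : ℤ → 𝕜) x (k : ℤ), (∀ n, ‖f n‖ ≤ C * ‖c x (n + k)‖) →
    ∃ y, c y = f ∧ ‖y‖ ≤ C * ‖x‖

/-- `T` acts as the bilateral weighted shift with weight `w` in the coordinates `c`. -/
def IsWeightedShift (c : E →ₗ[𝕜] ℤ → 𝕜) (w : ℤ → ℝ) (T : E → E) : Prop :=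
  ∀ x n, c (T x) n = (w (n + 1) : 𝕜) * c x (n + 1)

theorem IsWeightedShift.mul_iterate {T : E → E} (hT : IsWeightedShift c w T)
    (hu : IsPotential w u) (k : ℕ) (x : E) (n : ℤ) :
    (u n : 𝕜) * c (T^[k] x) n = (u (n + k) : 𝕜) * c x (n + k) := by
  induction k generalizing n with
  | zero => simp
  | succ k ih =>
    have hun : (u n : 𝕜) * (w (n + 1) : 𝕜) = (u (n + 1) : 𝕜) := by
      rw [hu.eq_mul (n + 1), add_sub_cancel_right, mul_comm, RCLike.ofReal_mul]
    rw [Function.iterate_succ_apply', hT, ← mul_assoc, hun, ih, Nat.cast_succ, add_assoc,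
      add_comm (1 : ℤ)]

theorem IsWeightedShift.injective_iterate_single {T : E → E} (hT : IsWeightedShift c w T)
    (hu : IsPotential w u) {z : E} {j : ℤ} (hz : c z = Pi.single j 1) :
    Function.Injective fun n : ℕ => T^[n] z := by
  intro m n hmn
  by_contra hne
  have h := hT.mul_iterate hu m z (j - m)
  rw [show T^[m] z = T^[n] z from hmn, hT.mul_iterate hu, hz, sub_add_cancel, Pi.single_eq_same,
    Pi.single_eq_of_ne (by omega), mul_zero, mul_one] at h
  exact (hu.pos j).ne (RCLike.ofReal_eq_zero.1 h.symm).symm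

namespace IsSequenceSpace

theorem exists_operator (hc : IsSequenceSpace c) {C : ℝ} {m : ℤ → 𝕜} (hm : ∀ n, ‖m n‖ ≤ C)
    (k : ℤ) : ∃ L : E →L[𝕜] E, ‖L‖ ≤ C ∧ ∀ x n, c (L x) n = m n * c x (n + k) := by
  have hC : 0 ≤ C := (norm_nonneg _).trans (hm 0)
  have hle (x : E) (n : ℤ) : ‖m n * c x (n + k)‖ ≤ C * ‖c x (n + k)‖ := by
    rw [norm_mul]
    exact mul_le_mul_of_nonneg_right (hm n) (norm_nonneg _)
  choose L hL hLle using fun x => hc.exists_of_le hC (fun n => m n * c x (n + k)) x k (hle x)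
  refine ⟨LinearMap.mkContinuous
    { toFun := L
      map_add' := fun x y => hc.injective (funext fun n => ?_)
      map_smul' := fun a x => hc.injective (funext fun n => ?_) } C hLle,
    LinearMap.mkContinuous_norm_le _ hC _, fun x n => congrFun (hL x) n⟩
  · simp only [map_add, hL, Pi.add_apply, mul_add]
  · simp only [map_smul, hL, Pi.smul_apply, smul_eq_mul, RingHom.id_apply, mul_left_comm]

theorem exists_continuousLinearEquiv (hc : IsSequenceSpace c) (hw : IsAdmissibleWeight w)
    {T : E →L[𝕜] E} (hT : IsWeightedShift c w T) : ∃ T' : E ≃L[𝕜] E, (T' : E →L[𝕜] E) = T := by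
  have hne (n : ℤ) : (w n : 𝕜) ≠ 0 := RCLike.ofReal_ne_zero.2 (hw.pos n).ne'
  obtain ⟨⟨a, ha, haw⟩, -⟩ := hw
  have hinv (n : ℤ) : ‖(w n : 𝕜)⁻¹‖ ≤ a⁻¹ := by
    rw [norm_inv, RCLike.norm_ofReal]
    exact inv_anti₀ ha ((haw n).trans (le_abs_self _))
  obtain ⟨L, -, hL⟩ := hc.exists_operator hinv (-1)
  refine ⟨.equivOfInverse T L (fun x => hc.injective (funext fun n => ?_))
    fun x => hc.injective (funext fun n => ?_), rfl⟩
  · rw [hL, hT, neg_add_cancel_right, inv_mul_cancel_left₀ (hne n)]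
  · rw [hT, hL, add_neg_cancel_right, mul_inv_cancel_left₀ (hne _)]

theorem exists_isGreenKernel (hc : IsSequenceSpace c) (hu : IsPotential w u) {T : E →L[𝕜] E}
    (hT : IsWeightedShift c w T) (hs : ContractsOn u s)
    (hs' : ContractsOn (reflect u) {j | -1 - j ∉ s}) : ∃ G, IsGreenKernel T G := by
  obtain ⟨a, ha, hle⟩ := exists_summable_forall_abs_greenCoeff_le hu.pos hs hs'
  have hop (m : ℤ) : ∃ L : E →L[𝕜] E, ‖L‖ ≤ a m ∧
      ∀ x n, c (L x) n = (greenCoeff u s m n : 𝕜) * c x (n + m) :=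
    hc.exists_operator (fun n => (RCLike.norm_ofReal _).trans_le (hle m n)) m
  choose G hGa hG using hop
  refine ⟨G, .of_nonneg_of_le (fun _ => norm_nonneg _) hGa ha, fun m x =>
    hc.injective (funext fun n => ?_)⟩
  rw [map_add, Pi.add_apply, hT, hG, hG, hu.greenCoeff_eq, show n + 1 + (m - 1) = n + m by ring,
    RCLike.ofReal_add, RCLike.ofReal_mul, add_mul, mul_assoc]
  congr 1
  split_ifs with hm
  · rw [hm, add_zero, RCLike.ofReal_one, one_mul]
  · rw [RCLike.ofReal_zero, zero_mul, map_zero, Pi.zero_apply]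

theorem stronglyStructurallyStable [CompleteSpace E] (hc : IsSequenceSpace c)
    (hw : IsAdmissibleWeight w) (hu : IsPotential w u) {T : E →L[𝕜] E}
    (hT : IsWeightedShift c w T) (hs : ContractsOn u s)
    (hs' : ContractsOn (reflect u) {j | -1 - j ∉ s}) : StronglyStructurallyStable T := by
  obtain ⟨G, hG⟩ := hc.exists_isGreenKernel hu hT hs hs'
  obtain ⟨T, rfl⟩ := hc.exists_continuousLinearEquiv hw hT
  exact hG.stronglyStructurallyStable

theorem exists_bounded_solution (hc : IsSequenceSpace c) (hu : IsPotential w u) {T : E →L[𝕜] E}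
    (hT : IsWeightedShift c w T) (h : StronglyStructurallyStable T) :
    ∃ δ : ℝ, 0 < δ ∧ ∃ b : ℤ → ℝ, (∀ j, |b j| ≤ 1) ∧ ∀ j, b (j - 1) = w j * b j + δ := by
  let := NormedSpace.restrictScalars ℝ 𝕜 E
  obtain ⟨δ, hδ, hsol⟩ := h.exists_bounded_solution
  choose e he he_le using hc.exists_single
  refine ⟨δ, hδ, exists_bounded_solution_of_forall_window fun N => ?_⟩
  have hforcing (n : ℕ) : ‖(δ : 𝕜) • e (N - n - 1)‖ ≤ δ := by
    rw [norm_smul, RCLike.norm_ofReal, abs_of_pos hδ]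
    exact mul_le_of_le_one_right hδ.le (he_le _)
  obtain ⟨v, hv_le, hv⟩ := hsol (e 0) (hT.injective_iterate_single hu (he 0)) (2 * N + 1) _ hforcing
  refine ⟨fun j => RCLike.re (c (v (N - j).toNat) j), fun j =>
    (RCLike.abs_re_le_norm _).trans ((hc.norm_coord_le _ _).trans (hv_le _)), fun j hj => ?_⟩
  obtain ⟨n, hn⟩ : ∃ n : ℕ, (N : ℤ) - j = n := ⟨(N - j).toNat, by have := hj.2; omega⟩
  have hcoord : c (v (n + 1)) (j - 1) = (w j : 𝕜) * c (v n) j + (δ : 𝕜) := by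
    rw [hv n (by have := hj.1; omega), map_add, map_smul, Pi.add_apply, Pi.smul_apply, hT, he,
      ← hn, sub_sub_cancel, Pi.single_eq_same, sub_add_cancel, smul_eq_mul, mul_one]
  beta_reduce
  rw [show (N - (j - 1) : ℤ).toNat = n + 1 by omega, show (N - j : ℤ).toNat = n by omega, hcoord,
    map_add, RCLike.re_ofReal_mul, RCLike.ofReal_re]

theorem exists_isSupersolution (hc : IsSequenceSpace c) (hu : IsPotential w u) {T : E →L[𝕜] E}
    (hT : IsWeightedShift c w T) (h : StronglyStructurallyStable T) :
    ∃ δ : ℝ, 0 < δ ∧ ∃ v, IsSupersolution δ u v := by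
  obtain ⟨δ, hδ, b, hb_le, hb⟩ := hc.exists_bounded_solution hu hT h
  refine ⟨δ, hδ, fun j => u j * b j, fun j => ?_, fun j => le_of_eq ?_⟩
  · rw [abs_mul, abs_of_pos (hu.pos j)]
    exact mul_le_of_le_one_right (hu.pos j).le (hb_le j)
  · rw [hb, hu.eq_mul j]
    ring

end IsSequenceSpace

/-- The space `ℓ_p(ℤ)` in its standard coordinates. -/
def lpCoord (𝕜 : Type*) [RCLike 𝕜] (p : ℝ≥0∞) [Fact (1 ≤ p)] :
    lp (fun _ : ℤ => 𝕜) p →ₗ[𝕜] ℤ → 𝕜 where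
  toFun x := x
  map_add' _ _ := rfl
  map_smul' _ _ := rfl

theorem isSequenceSpace_lp (𝕜 : Type*) [RCLike 𝕜] {p : ℝ≥0∞} [Fact (1 ≤ p)] (hp : p ≠ ∞) :
    IsSequenceSpace (lpCoord 𝕜 p) where
  injective x y h := lp.ext h
  norm_coord_le x n := lp.norm_apply_le_norm (zero_lt_one.trans_le Fact.out).ne' x n
  exists_single j :=
    ⟨lp.single p j 1, funext fun n => lp.single_apply p j 1 n, by
      rw [lp.norm_single (zero_lt_one.trans_le Fact.out), norm_one]⟩
  exists_of_le {C} hC f x k h := by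
    have hp0 : 0 < p.toReal := ENNReal.toReal_pos (zero_lt_one.trans_le Fact.out).ne' hp
    have hx : HasSum (fun n : ℤ => ‖x (n + k)‖ ^ p.toReal) (‖x‖ ^ p.toReal) :=
      (Equiv.addRight k).hasSum_iff.2 (lp.hasSum_norm hp0 x)
    have hle (n : ℤ) : ‖f n‖ ^ p.toReal ≤ C ^ p.toReal * ‖x (n + k)‖ ^ p.toReal := by
      rw [← Real.mul_rpow hC (norm_nonneg _)]
      exact Real.rpow_le_rpow (norm_nonneg _) (h n) hp0.le
    have hCx := hx.mul_left (C ^ p.toReal)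
    have hf : Summable fun n => ‖f n‖ ^ p.toReal :=
      hCx.summable.of_nonneg_of_le (fun n => by positivity) hle
    have hnorm : ‖(⟨f, memℓp_gen hf⟩ : lp (fun _ : ℤ => 𝕜) p)‖ ≤ C * ‖x‖ := by
      refine lp.norm_le_of_tsum_le hp0 (mul_nonneg hC (norm_nonneg x)) ?_
      rw [Real.mul_rpow hC (norm_nonneg _)]
      exact hasSum_le hle hf.hasSum hCx
    exact ⟨⟨f, memℓp_gen hf⟩, rfl, hnorm⟩

theorem norm_zeroAtInfty_le_iff {X F : Type*} [TopologicalSpace X] [NormedAddCommGroup F]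
    {x : C₀(X, F)} {C : ℝ} (hC : 0 ≤ C) : ‖x‖ ≤ C ↔ ∀ n, ‖x n‖ ≤ C := by
  rw [← ZeroAtInftyContinuousMap.norm_toBCF_eq_norm]
  exact BoundedContinuousFunction.norm_le hC

/-- The space `c_0(ℤ)` in its standard coordinates. -/
def zeroAtInftyCoord (𝕜 : Type*) [RCLike 𝕜] : C₀(ℤ, 𝕜) →ₗ[𝕜] ℤ → 𝕜 where
  toFun x := x
  map_add' _ _ := rfl
  map_smul' _ _ := rfl

theorem isSequenceSpace_zeroAtInfty (𝕜 : Type*) [RCLike 𝕜] :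
    IsSequenceSpace (zeroAtInftyCoord 𝕜) where
  injective x y h := DFunLike.coe_injective h
  norm_coord_le x n := (norm_zeroAtInfty_le_iff (norm_nonneg x)).1 le_rfl n
  exists_single j := by
    have hlim : Tendsto (Pi.single j 1 : ℤ → 𝕜) (cocompact ℤ) (𝓝 0) := by
      refine tendsto_nhds_of_eventually_eq ?_
      rw [cocompact_eq_cofinite]
      filter_upwards [(Set.finite_singleton j).compl_mem_cofinite] with n hn
      exact Pi.single_eq_of_ne hn 1
    refine ⟨⟨⟨Pi.single j 1, continuous_of_discreteTopology⟩, hlim⟩, rfl,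
      (norm_zeroAtInfty_le_iff zero_le_one).2 fun n => ?_⟩
    change ‖(Pi.single j 1 : ℤ → 𝕜) n‖ ≤ 1
    rcases eq_or_ne n j with rfl | hn
    · rw [Pi.single_eq_same, norm_one]
    · rw [Pi.single_eq_of_ne hn, norm_zero]
      exact zero_le_one
  exists_of_le {C} hC f x k h := by
    have hx : Tendsto (fun n : ℤ => x (n + k)) (cocompact ℤ) (𝓝 0) :=
      x.zero_at_infty'.comp (Homeomorph.addRight k).isClosedEmbedding.tendsto_cocompact
    have hf : Tendsto f (cocompact ℤ) (𝓝 0) :=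
      squeeze_zero_norm (a := fun n => C * ‖x (n + k)‖) h (by
        simpa only [norm_zero, mul_zero] using hx.norm.const_mul C)
    refine ⟨⟨⟨f, continuous_of_discreteTopology⟩, hf⟩, rfl,
      (norm_zeroAtInfty_le_iff (by positivity)).2 fun n => (h n).trans ?_⟩
    exact mul_le_mul_of_nonneg_left
      ((norm_zeroAtInfty_le_iff (norm_nonneg x)).1 le_rfl (n + k)) hC

end SequenceSpace

end BilateralShift

open BilateralShift in
theorem theorem1p1_general {𝕜 E : Type*} [RCLike 𝕜] [NormedAddCommGroup E] [NormedSpace 𝕜 E]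
    [CompleteSpace E] {c : E →ₗ[𝕜] ℤ → 𝕜} (hc : IsSequenceSpace c) {w : ℤ → ℝ}
    (hw : IsAdmissibleWeight w) {T : E →L[𝕜] E} (hT : IsWeightedShift c w T) :
    StronglyStructurallyStable T ↔ ConditionA w ∨ ConditionB w ∨ ConditionC w := by
  obtain ⟨u, hu⟩ := exists_isPotential hw.pos
  obtain ⟨b, hb⟩ := hw.exists_hasBoundedRatios hu
  rw [hu.conditionA_iff hb, hu.conditionB_iff hb, hu.conditionC_iff hb]
  constructor
  · intro h
    obtain ⟨δ, hδ, v, hv⟩ := hc.exists_isSupersolution hu hT h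
    exact hv.trichotomy hb hδ
  · rintro (h | h | ⟨h, h'⟩)
    · exact hc.stronglyStructurallyStable hw hu hT h
        ((contractsOn_empty _).mono fun j hj => hj (Set.mem_univ _))
    · exact hc.stronglyStructurallyStable hw hu hT (contractsOn_empty u)
        (h.mono (Set.subset_univ _))
    · exact hc.stronglyStructurallyStable hw hu hT h (h'.mono fun j hj => by
        simp only [Set.mem_ofPred_eq, Set.mem_Iio] at hj ⊢; omega)

theorem theorem1p1 {𝕜 : Type*} [RCLike 𝕜] (w : ℤ → ℝ) (hw : BilateralShift.IsAdmissibleWeight w) :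
    (∀ (p : ℝ≥0∞) [Fact (1 ≤ p)] (hp : p ≠ ∞),
      BilateralShift.StronglyStructurallyStable (BilateralShift.shiftLp 𝕜 p hp w hw) ↔
        BilateralShift.ConditionA w ∨ BilateralShift.ConditionB w ∨
          BilateralShift.ConditionC w) ∧
    (BilateralShift.StronglyStructurallyStable (BilateralShift.shiftC0 𝕜 w hw) ↔
      BilateralShift.ConditionA w ∨ BilateralShift.ConditionB w ∨
        BilateralShift.ConditionC w) :=
  ⟨fun _ _ hp => theorem1p1_general (BilateralShift.isSequenceSpace_lp 𝕜 hp) hw fun _ _ => rfl,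
    theorem1p1_general (BilateralShift.isSequenceSpace_zeroAtInfty 𝕜) hw fun _ _ => rfl⟩
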